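/- Let $d\ge 1$, $R>0$, $0<\lambda_{\min}<\lambda_{\max}$, let $\mathcal X\subseteq\{x\in\mathbb R^d:\|x\|\le R\}$ be measurable, and let $\mathbb S$ be the set of symmetric positive definite $d\times d$ matrices with all eigenvalues in $[\lambda_{\min},\lambda_{\max}]$. Let $f(x\mid\theta,\Sigma)$ be a density kernel: for each $\theta\in\mathbb R^d$ and $\Sigma\in\mathbb S$ it is a probability density in $x\in\mathbb R^d$, and $f(x\mid\theta,\Sigma)=f(x-\theta\mid 0,\Sigma)$. Let $\Phi_\Sigma(\xi)=\int e^{i\xi^\top x}f(x\mid 0,\Sigma)\,dx$. Let $\mathscr G$ be the set of $G=P\times\delta_\Sigma$ with $P$ a Borel probability measure on $\mathbb R^d$, $\mathrm{supp}(P)\subseteq\mathcal X$, and $\Sigma\in\mathbb S$; put $p_G(x)=\int f(x\mid\theta,\Sigma)\,P(d\theta)$. Let $\|\cdot\|_1$ be the $L^1(\mathbb R^d)$ norm, $\|\cdot\|_{\mathrm{op}}$ the operator norm, and $W_1$ the Wasserstein distance of order $1$ with Euclidean ground metric. Assume that there are strictly increasing $\Psi,\Xi:[0,\infty)\to[0,\infty)$,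 reals $p\ge 1$, $\beta>0$ and constants $A,B,c_1,c_2>0$ such that 1. $\|p_G-p_{G'}\|_1\ge A\,\Psi(\|\Sigma-\Sigma'\|_{\mathrm{op}})$ for all $G=P\times\delta_\Sigma$ and $G'=P'\times\delta_{\Sigma'}$ in $\mathscr G$; 2. $|\Phi_{\Sigma'}(\xi)-\Phi_\Sigma(\xi)|\le B\,\Xi(\|\Sigma-\Sigma'\|_{\mathrm{op}})\,\|\xi\|^p\max\{|\Phi_{\Sigma'}(\xi)|,|\Phi_\Sigma(\xi)|\}$ for all $\xi\in\mathbb R^d$ and $\Sigma,\Sigma'\in\mathbb S$; 3. ($f$ is ordinary-smooth of order $\beta$) $c_1(1+\|\xi\|^\beta)^{-1}\le|\Phi_\Sigma(\xi)|\le c_2(1+\|\xi\|^\beta)^{-1}$ for all $\xi\in\mathbb R^d$ and $\Sigma\in\mathbb S$. Then there exist constants $C,C'>0$, depending only on $R,\lambda_{\min},\lambda_{\max},d,p,\beta,A,B,c_1,c_2$, such that for all $G=P\times\delta_\Sigma$ and $G'=P'\times\delta_{\Sigma'}$ in $\mathscr G$ $$\|p_G-p_{G'}\|_1\ \ge\ C'\Big[\Psi(\|\Sigma-\Sigma'\|_{\mathrm{op}})+\min\big\{W_1(P,P')^{d+\beta+1},\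 (\Psi\circ\Xi^{-1})\big(C\,W_1(P,P')^{d+p+1}\big)\big\}\Big].$$ Here $\Xi^{-1}(y)=\inf\{t\ge 0:\Xi(t)\ge y\}$ with $\inf\emptyset=\infty$ (the ordinary inverse on the range of $\Xi$), and $\Psi(\infty)=\sup\Psi$. -/

import Mathlib

open MeasureTheory Set
open scoped NNReal ENNReal

noncomputable section

namespace LocScaleMixture

/-- Euclidean space `ℝ^d`. -/
abbrev E (d : ℕ) : Type := EuclideanSpace ℝ (Fin d)

/-- Real `d × d` matrices. -/
abbrev Mat (d : ℕ) : Type := Matrix (Fin d) (Fin d) ℝ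

/-- The operator norm of a matrix acting on Euclidean space. For a symmetric matrix `S`, such as
a difference of two scale matrices, it equals `max_{‖v‖ ≤ 1} |vᵀ S v|`. -/
def opNorm {d : ℕ} (S : Mat d) : ℝ≥0 := ‖Matrix.toEuclideanCLM (n := Fin d) (𝕜 := ℝ) S‖₊

/-- The symmetric positive definite matrices with all eigenvalues in `[lmin, lmax]`. -/
def scaleSet (d : ℕ) (lmin lmax : ℝ) : Set (Mat d) :=
  {S | ∃ h : S.PosDef, ∀ i, h.isHermitian.eigenvalues i ∈ Icc lmin lmax}

/-- The parameter space of mixing measures `G = P × δ_S`, where `P` is a Borel probability measure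
whose support lies in `X` and `S` is a scale matrix. Such a `G` is recorded as the pair
`(P, S)`. -/
def mixingSet {d : ℕ} (X : Set (E d)) (lmin lmax : ℝ) : Set (ProbabilityMeasure (E d) × Mat d) :=
  {G | (G.1 : Measure (E d)).support ⊆ X ∧ G.2 ∈ scaleSet d lmin lmax}

/-- `f x θ S`, read as `f(x ∣ θ, S)`, is a density kernel with location parameter `θ`: for each
scale `S` and location `θ` it is a probability density in `x`, and `θ` acts by translation. -/
structure IsDensityKernel {d : ℕ} (lmin lmax : ℝ) (f : E d → E d → Mat d → ℝ) : Prop where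
  measurable : ∀ S ∈ scaleSet d lmin lmax, ∀ θ, Measurable fun x ↦ f x θ S
  nonneg : ∀ S ∈ scaleSet d lmin lmax, ∀ x θ, 0 ≤ f x θ S
  lintegral_eq_one : ∀ S ∈ scaleSet d lmin lmax, ∀ θ, ∫⁻ x, ENNReal.ofReal (f x θ S) = 1
  translation : ∀ S ∈ scaleSet d lmin lmax, ∀ x θ, f x θ S = f (x - θ) 0 S

/-- The mixture density `p_G(x) = ∫ f(x ∣ θ, S) P(dθ)` for `G = P × δ_S`. -/
def mixDensity {d : ℕ} (f : E d → E d → Mat d → ℝ) (G : ProbabilityMeasure (E d) × Mat d)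
    (x : E d) : ℝ :=
  ∫ θ, f x θ G.2 ∂(G.1 : Measure (E d))

/-- The distance `‖p - q‖₁` in `L¹(ℝ^d)` with respect to Lebesgue measure. -/
def l1Dist {d : ℕ} (p q : E d → ℝ) : ℝ≥0∞ := eLpNorm (fun x ↦ p x - q x) 1 volume

/-- The characteristic function `Φ_S(ξ) = ∫ exp(i ξᵀx) f(x ∣ 0, S) dx`. -/
def kernelCharFun {d : ℕ} (f : E d → E d → Mat d → ℝ) (S : Mat d) (ξ : E d) : ℂ :=
  ∫ x, Complex.exp (Complex.I * (inner ℝ ξ x : ℝ)) * (f x 0 S : ℂ)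

/-- The Wasserstein distance `W₁` for the Euclidean ground metric: the infimum of the transport
cost `∫ ‖x - y‖ dπ(x, y)` over all couplings `π` of `P` and `Q`. -/
def W1 {d : ℕ} (P Q : ProbabilityMeasure (E d)) : ℝ≥0∞ :=
  ⨅ π : {π : Measure (E d × E d) //
      π.map Prod.fst = (P : Measure (E d)) ∧ π.map Prod.snd = (Q : Measure (E d))},
    ∫⁻ z, edist z.1 z.2 ∂π.1

/-- The `L¹` distance of mixture densities dominates `A * Ψ(‖S - S'‖)`. -/
def ScaleLowerBound {d : ℕ} (X : Set (E d)) (lmin lmax : ℝ) (f : E d → E d → Mat d → ℝ)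
    (Ψ : ℝ≥0 → ℝ≥0) (A : ℝ≥0) : Prop :=
  ∀ G ∈ mixingSet X lmin lmax, ∀ G' ∈ mixingSet X lmin lmax,
    (A : ℝ≥0∞) * Ψ (opNorm (G.2 - G'.2)) ≤ l1Dist (mixDensity f G) (mixDensity f G')

/-- The characteristic function varies with the scale at most like
`B * Ξ(‖S - S'‖) * ‖ξ‖ ^ p`, relative to its own magnitude. -/
def CharFunModulus {d : ℕ} (lmin lmax : ℝ) (f : E d → E d → Mat d → ℝ)
    (p : ℝ) (Ξ : ℝ≥0 → ℝ≥0) (B : ℝ≥0) : Prop :=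
  ∀ ξ : E d, ∀ S ∈ scaleSet d lmin lmax, ∀ S' ∈ scaleSet d lmin lmax,
    ‖kernelCharFun f S' ξ - kernelCharFun f S ξ‖ ≤
      B * Ξ (opNorm (S - S')) * ‖ξ‖ ^ p * max ‖kernelCharFun f S' ξ‖ ‖kernelCharFun f S ξ‖

/-- The kernel is ordinary-smooth of order `β`, with constants `c₁` and `c₂`. -/
def OrdinarySmooth {d : ℕ} (lmin lmax : ℝ) (f : E d → E d → Mat d → ℝ) (β c₁ c₂ : ℝ) : Prop :=
  ∀ ξ : E d, ∀ S ∈ scaleSet d lmin lmax,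
    c₁ * (1 + ‖ξ‖ ^ β)⁻¹ ≤ ‖kernelCharFun f S ξ‖ ∧
      ‖kernelCharFun f S ξ‖ ≤ c₂ * (1 + ‖ξ‖ ^ β)⁻¹

/-- The inverse of an increasing function, `Ξ⁻¹(y) = inf {t ≥ 0 : y ≤ Ξ(t)}`, with the infimum of
the empty set equal to `∞`. It is the usual inverse on the range of `Ξ`. -/
def incrInv (Ξ : ℝ≥0 → ℝ≥0) (y : ℝ≥0∞) : ℝ≥0∞ :=
  ⨅ (t : ℝ≥0) (_ : y ≤ (Ξ t : ℝ≥0∞)), (t : ℝ≥0∞)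

/-- An increasing function `Ψ` on `[0, ∞)`, extended to `[0, ∞]` by `Ψ(∞) = sup Ψ`. -/
def extendTop (Ψ : ℝ≥0 → ℝ≥0) (s : ℝ≥0∞) : ℝ≥0∞ :=
  ⨆ (t : ℝ≥0) (_ : (t : ℝ≥0∞) ≤ s), (Ψ t : ℝ≥0∞)

theorem incrInv_apply {Ξ : ℝ≥0 → ℝ≥0} (h : StrictMono Ξ) (t : ℝ≥0) :
    incrInv Ξ (Ξ t : ℝ≥0∞) = t := by
  refine le_antisymm (iInf₂_le_of_le t le_rfl le_rfl) (le_iInf₂ fun s hs ↦ ?_)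
  exact_mod_cast h.le_iff_le.1 (ENNReal.coe_le_coe.1 hs)

theorem extendTop_coe {Ψ : ℝ≥0 → ℝ≥0} (h : StrictMono Ψ) (t : ℝ≥0) :
    extendTop Ψ (t : ℝ≥0∞) = Ψ t := by
  refine le_antisymm (iSup₂_le fun s hs ↦ ?_) (le_iSup₂_of_le t le_rfl le_rfl)
  exact_mod_cast h.monotone (ENNReal.coe_le_coe.1 hs)

end LocScaleMixture

end

namespace LocScaleMixture

open ProbabilityTheory

/-! Write `W` for the Wasserstein distance of the location measures, `L` for the `L¹` distance of
the mixtures and `t` for the distance of the scales. A mixture is a convolution, so its Fourier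
transform is `charFun P` times the kernel's characteristic function, and the difference of two such
products is at most `L` everywhere. Dividing by the larger kernel factor, which ordinary smoothness
bounds below, bounds the difference of the `charFun`s by `L / c₁ * (1 + ‖ξ‖ ^ β) + B * Ξ t * ‖ξ‖ ^
p` (`norm_charFun_sub_le`).

To return to `W`, convolve both measures with a Gaussian of width `δ`. This moves each by `O(δ)`,
and by Fourier inversion the smoothed densities differ uniformly by `O(L δ^(-(d+β)) + Ξ t
δ^(-(d+p)))`. As the measures live in a ball, `W` is at most `O(δ)` plus a multiple of that bound
(`W1_le_of_smoothDensity_le`). With `δ` a small multiple of `W` itself, the `O(δ)` part is absorbed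
in the left side, and one of the two remaining terms must dominate: either `W ^ (d+β+1) ≲ L` or `W ^
(d+p+1) ≲ Ξ t` (`exists_W1_rpow_le`).

The first alternative bounds the minimum by its first entry. In the second, `Ξ⁻¹(C W ^ (d+p+1)) ≤
t`, so the second entry is at most `Ψ t`, which the scale lower bound controls by `L`. -/

variable {d : ℕ}

/-! ### Couplings and the Wasserstein distance -/

theorem W1_le_of_coupling {P Q : ProbabilityMeasure (E d)} (π : Measure (E d × E d))
    (h₁ : π.map Prod.fst = (P : Measure (E d))) (h₂ : π.map Prod.snd = (Q : Measure (E d))) :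
    W1 P Q ≤ ∫⁻ z, edist z.1 z.2 ∂π :=
  iInf_le_of_le ⟨π, h₁, h₂⟩ le_rfl

theorem W1_comm_le (P Q : ProbabilityMeasure (E d)) : W1 P Q ≤ W1 Q P := by
  refine le_iInf fun π ↦ ?_
  refine (W1_le_of_coupling (π.1.map Prod.swap) ?_ ?_).trans ?_
  · rw [Measure.map_map measurable_fst measurable_swap]
    exact π.2.2
  · rw [Measure.map_map measurable_snd measurable_swap]
    exact π.2.1
  · rw [lintegral_map (by fun_prop) measurable_swap]
    simp [edist_comm]

theorem W1_comm (P Q : ProbabilityMeasure (E d)) : W1 P Q = W1 Q P :=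
  le_antisymm (W1_comm_le P Q) (W1_comm_le Q P)

/-- Gluing of two measures along a common first marginal. -/
theorem exists_gluing {α β γ : Type*} [MeasurableSpace α] [MeasurableSpace β]
    [MeasurableSpace γ] [StandardBorelSpace β] [StandardBorelSpace γ] [Nonempty β] [Nonempty γ]
    (ρ : Measure (α × β)) (σ : Measure (α × γ)) [IsFiniteMeasure ρ] [IsFiniteMeasure σ]
    (h : ρ.fst = σ.fst) :
    ∃ τ : Measure (α × β × γ), τ.map (fun z ↦ (z.1, z.2.1)) = ρ ∧
      τ.map (fun z ↦ (z.1, z.2.2)) = σ := by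
  -- The last two coordinates are made conditionally independent given the common one.
  refine ⟨ρ.fst ⊗ₘ (ρ.condKernel ×ₖ σ.condKernel), ?_, ?_⟩
  · have : (fun z : α × β × γ ↦ (z.1, z.2.1)) = Prod.map id Prod.fst := rfl
    rw [this, ← Measure.compProd_map measurable_fst, ← Kernel.fst_eq, Kernel.fst_prod,
      ρ.disintegrate]
  · have : (fun z : α × β × γ ↦ (z.1, z.2.2)) = Prod.map id Prod.snd := rfl
    rw [this, ← Measure.compProd_map measurable_snd, ← Kernel.snd_eq, Kernel.snd_prod, h,
      σ.disintegrate]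

theorem W1_triangle (P S Q : ProbabilityMeasure (E d)) : W1 P Q ≤ W1 P S + W1 S Q := by
  rw [W1_comm P S]
  refine ENNReal.le_iInf_add_iInf fun ρ σ ↦ ?_
  have hρ : IsFiniteMeasure ρ.1 := by
    have : IsFiniteMeasure (ρ.1.map Prod.fst) := by rw [ρ.2.1]; infer_instance
    exact Measure.isFiniteMeasure_of_map (by fun_prop : AEMeasurable Prod.fst ρ.1)
  have hσ : IsFiniteMeasure σ.1 := by
    have : IsFiniteMeasure (σ.1.map Prod.fst) := by rw [σ.2.1]; infer_instance
    exact Measure.isFiniteMeasure_of_map (by fun_prop : AEMeasurable Prod.fst σ.1)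
  obtain ⟨τ, h₁, h₂⟩ := exists_gluing ρ.1 σ.1 (ρ.2.1.trans σ.2.1.symm)
  refine (W1_le_of_coupling (τ.map Prod.snd) ?_ ?_).trans ?_
  · rw [← ρ.2.2, ← h₁, Measure.map_map (by fun_prop) (by fun_prop),
      Measure.map_map (by fun_prop) (by fun_prop)]
    rfl
  · rw [← σ.2.2, ← h₂, Measure.map_map (by fun_prop) (by fun_prop),
      Measure.map_map (by fun_prop) (by fun_prop)]
    rfl
  · rw [← h₁, ← h₂, lintegral_map (by fun_prop) (by fun_prop),
      lintegral_map (by fun_prop) (by fun_prop), lintegral_map (by fun_prop) (by fun_prop),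
      ← lintegral_add_left (by fun_prop)]
    gcongr with z
    exact edist_triangle_left _ _ _

/-- Two densities are at Wasserstein distance at most the first absolute moment of their
difference: the common part stays in place, the remaining parts are coupled independently. -/
theorem W1_withDensity_le {P Q : ProbabilityMeasure (E d)} (μ : Measure (E d)) [SFinite μ]
    {q q' : E d → ℝ≥0∞} (hq : Measurable q) (hq' : Measurable q')
    (hP : (P : Measure (E d)) = μ.withDensity q) (hQ : (Q : Measure (E d)) = μ.withDensity q') :
    W1 P Q ≤ ∫⁻ x, ‖x‖ₑ * ((q x - q' x) + (q' x - q x)) ∂μ := by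
  set ν := μ.withDensity (fun x ↦ min (q x) (q' x)) with hν
  set a := μ.withDensity (fun x ↦ q x - q' x) with ha
  set b := μ.withDensity (fun x ↦ q' x - q x) with hb
  have hPa : (P : Measure (E d)) = ν + a := by
    rw [hP, hν, ha, ← withDensity_add_left (hq.min hq')]
    congr 1; ext x
    rw [Pi.add_apply]
    rcases le_total (q x) (q' x) with h | h
    · simp [h, tsub_eq_zero_of_le h]
    · simp [h, add_tsub_cancel_of_le]
  have hQb : (Q : Measure (E d)) = ν + b := by
    rw [hQ, hν, hb, ← withDensity_add_left (hq.min hq')]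
    congr 1; ext x
    rw [Pi.add_apply]
    rcases le_total (q x) (q' x) with h | h
    · simp [h, add_tsub_cancel_of_le]
    · simp [h, tsub_eq_zero_of_le h]
  have hP1 : ν univ + a univ = 1 := by
    rw [← Measure.add_apply, ← hPa]; simp
  have hQ1 : ν univ + b univ = 1 := by
    rw [← Measure.add_apply, ← hQb]; simp
  have hνtop : ν univ ≠ ∞ := ne_top_of_le_ne_top ENNReal.one_ne_top (hP1 ▸ le_self_add)
  have hatop : a univ ≠ ∞ := ne_top_of_le_ne_top ENNReal.one_ne_top (hP1 ▸ le_add_self)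
  have hab : b univ = a univ := by
    rw [← hP1] at hQ1
    exact (ENNReal.add_right_inj hνtop).1 hQ1
  have hfa : IsFiniteMeasure a := ⟨hatop.lt_top⟩
  have hfb : IsFiniteMeasure b := ⟨hab ▸ hatop.lt_top⟩
  set m := a univ with hm
  -- If `m = 0`, then `m⁻¹ = ∞`, but the leftover measures vanish, so the normalisation is still
  -- harmless.
  have hsm : ∀ c : Measure (E d), c univ = m → m⁻¹ • m • c = c := by
    intro c hc
    rcases eq_or_ne m 0 with h0 | h0
    · rw [Measure.measure_univ_eq_zero.1 (hc.trans h0)]; simp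
    · rw [smul_smul, ENNReal.inv_mul_cancel h0 hatop, one_smul]
  refine (W1_le_of_coupling (ν.map (fun x ↦ (x, x)) + m⁻¹ • a.prod b) ?_ ?_).trans ?_
  · rw [Measure.map_add _ _ measurable_fst, Measure.map_map measurable_fst (by fun_prop),
      Measure.map_smul, Measure.map_fst_prod, hab, hsm a hm.symm, hPa]
    simp [Function.comp_def]
  · rw [Measure.map_add _ _ measurable_snd, Measure.map_map measurable_snd (by fun_prop),
      Measure.map_smul, Measure.map_snd_prod, ← hm, hsm b hab, hQb]
    simp [Function.comp_def]
  · rw [lintegral_add_measure, lintegral_map (by fun_prop) (by fun_prop), lintegral_smul_measure]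
    have h1 : ∫⁻ z, edist z.1 z.2 ∂(a.prod b) ≤ m * (∫⁻ x, ‖x‖ₑ ∂a + ∫⁻ x, ‖x‖ₑ ∂b) := by
      calc ∫⁻ z, edist z.1 z.2 ∂(a.prod b) ≤ ∫⁻ z, (‖z.1‖ₑ + ‖z.2‖ₑ) ∂(a.prod b) := by
            gcongr with z
            rw [edist_eq_enorm_sub]
            exact enorm_sub_le
        _ = ∫⁻ z, ‖z.1‖ₑ ∂(a.prod b) + ∫⁻ z, ‖z.2‖ₑ ∂(a.prod b) :=
            lintegral_add_left (by fun_prop) _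
        _ = ∫⁻ x, ‖x‖ₑ ∂((a.prod b).map Prod.fst) + ∫⁻ x, ‖x‖ₑ ∂((a.prod b).map Prod.snd) := by
            rw [lintegral_map (by fun_prop) measurable_fst,
              lintegral_map (by fun_prop) measurable_snd]
        _ = m * (∫⁻ x, ‖x‖ₑ ∂a + ∫⁻ x, ‖x‖ₑ ∂b) := by
            rw [Measure.map_fst_prod, Measure.map_snd_prod, hab, ← hm, lintegral_smul_measure,
              lintegral_smul_measure, smul_eq_mul, smul_eq_mul, mul_add]
    have h2 : ∫⁻ x, ‖x‖ₑ * ((q x - q' x) + (q' x - q x)) ∂μ = ∫⁻ x, ‖x‖ₑ ∂a + ∫⁻ x, ‖x‖ₑ ∂b := by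
      have hm₁ : Measurable fun x ↦ q x - q' x := hq.sub hq'
      have hm₂ : Measurable fun x ↦ q' x - q x := hq'.sub hq
      rw [ha, hb, lintegral_withDensity_eq_lintegral_mul _ hm₁ measurable_enorm,
        lintegral_withDensity_eq_lintegral_mul _ hm₂ measurable_enorm,
        ← lintegral_add_left (by fun_prop)]
      congr 1; ext x
      simp only [Pi.mul_apply]
      ring
    rw [h2]
    simp only [edist_self, lintegral_zero, zero_add, smul_eq_mul]
    calc m⁻¹ * ∫⁻ z, edist z.1 z.2 ∂(a.prod b)
        ≤ m⁻¹ * (m * (∫⁻ x, ‖x‖ₑ ∂a + ∫⁻ x, ‖x‖ₑ ∂b)) := by gcongr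
      _ = (m⁻¹ * m) * (∫⁻ x, ‖x‖ₑ ∂a + ∫⁻ x, ‖x‖ₑ ∂b) := by ring
      _ ≤ 1 * (∫⁻ x, ‖x‖ₑ ∂a + ∫⁻ x, ‖x‖ₑ ∂b) := by
          gcongr
          exact ENNReal.inv_mul_le_one m
      _ = _ := one_mul _

/-! ### Smoothing by convolution -/

/-- The density of the convolution of a measure with a density. -/
noncomputable def smoothDensity (K : E d → ℝ≥0∞) (P : Measure (E d)) (x : E d) : ℝ≥0∞ := ∫⁻ y, K (x - y) ∂P

theorem measurable_smoothDensity {K : E d → ℝ≥0∞} (hK : Measurable K) (P : Measure (E d))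
    [SFinite P] : Measurable (smoothDensity K P) := by
  unfold smoothDensity
  exact Measurable.lintegral_prod_right' (f := fun z : E d × E d ↦ K (z.1 - z.2)) (by fun_prop)

theorem lintegral_mul_smoothDensity {K g : E d → ℝ≥0∞} (hK : Measurable K) (hg : Measurable g)
    (P : Measure (E d)) [SFinite P] :
    ∫⁻ x, g x * smoothDensity K P x = ∫⁻ y, ∫⁻ x, g x * K (x - y) ∂volume ∂P := by
  rw [lintegral_lintegral_swap (by fun_prop)]
  refine lintegral_congr fun x ↦ ?_
  rw [smoothDensity, lintegral_const_mul _ (by fun_prop)]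

theorem isProbabilityMeasure_smoothDensity {K : E d → ℝ≥0∞} (hK : Measurable K)
    (hK1 : ∫⁻ z, K z = 1) (P : Measure (E d)) [IsProbabilityMeasure P] :
    IsProbabilityMeasure (volume.withDensity (smoothDensity K P)) := by
  refine ⟨?_⟩
  have := lintegral_mul_smoothDensity hK (measurable_const (a := (1 : ℝ≥0∞))) P
  simp only [one_mul] at this
  rw [withDensity_apply _ MeasurableSet.univ, Measure.restrict_univ, this]
  simp [lintegral_sub_right_eq_self K, hK1]

/-- Smoothing moves a measure by at most the first absolute moment of the smoothing kernel. -/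
theorem W1_smoothDensity_le {K : E d → ℝ≥0∞} (hK : Measurable K) (hK1 : ∫⁻ z, K z = 1)
    (P S : ProbabilityMeasure (E d))
    (hS : (S : Measure (E d)) = volume.withDensity (smoothDensity K P)) :
    W1 P S ≤ ∫⁻ z, ‖z‖ₑ * K z := by
  have hm : Measurable fun z : E d × E d ↦ K (z.2 - z.1) := by fun_prop
  -- The coupling is the law of `(Y, Y + Z)` with `Y` distributed as `P` and `Z` independent with
  -- density `K`.
  refine (W1_le_of_coupling
    (((P : Measure (E d)).prod volume).withDensity fun z ↦ K (z.2 - z.1)) ?_ ?_).trans ?_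
  · ext s hs
    rw [Measure.map_apply measurable_fst hs, withDensity_apply _ (measurable_fst hs),
      ← lintegral_indicator (measurable_fst hs),
      lintegral_prod _ (by exact (hm.indicator (measurable_fst hs)).aemeasurable)]
    have : ∀ y, ∫⁻ x, (Prod.fst ⁻¹' s).indicator (fun z : E d × E d ↦ K (z.2 - z.1)) (y, x)
        = s.indicator 1 y := by
      intro y
      by_cases hy : y ∈ s
      · simp [indicator, hy, lintegral_sub_right_eq_self K, hK1]
      · simp [indicator, hy]
    simp_rw [this]
    rw [lintegral_indicator_one hs]
  · ext s hs
    rw [Measure.map_apply measurable_snd hs, withDensity_apply _ (measurable_snd hs),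
      ← lintegral_indicator (measurable_snd hs),
      lintegral_prod_symm _ (by exact (hm.indicator (measurable_snd hs)).aemeasurable), hS,
      withDensity_apply _ hs, ← lintegral_indicator hs]
    refine lintegral_congr fun x ↦ ?_
    by_cases hx : x ∈ s <;> simp [indicator, hx, smoothDensity]
  · rw [lintegral_withDensity_eq_lintegral_mul _ hm (measurable_fst.edist measurable_snd),
      lintegral_prod _ (by fun_prop)]
    have : ∀ y, ∫⁻ x, ((fun z : E d × E d ↦ K (z.2 - z.1)) * fun z : E d × E d ↦ edist z.1 z.2) (y, x)
        = ∫⁻ z, ‖z‖ₑ * K z := by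
      intro y
      rw [← lintegral_sub_right_eq_self (fun z ↦ ‖z‖ₑ * K z) y]
      refine lintegral_congr fun x ↦ ?_
      simp only [Pi.mul_apply]
      rw [edist_comm, edist_eq_enorm_sub, mul_comm]
    refine (lintegral_congr this).trans_le ?_
    simp

/-- If `‖y‖ ≤ R` and `‖x‖ > 2 * R`, then `‖x‖ ≤ 2 * ‖x - y‖`, so far from the supports the first
moment is paid for by the kernel alone. Hence the radius `2 * R`. -/
theorem setLIntegral_smoothDensity_le {K : E d → ℝ≥0∞} (hK : Measurable K)
    (P : Measure (E d)) [IsProbabilityMeasure P] {R : ℝ}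
    (hP : ∀ᵐ y ∂P, ‖y‖ ≤ R) :
    ∫⁻ x in (Metric.closedBall 0 (2 * R))ᶜ, ‖x‖ₑ * smoothDensity K P x ≤
      2 * ∫⁻ z, ‖z‖ₑ * K z := by
  have hs : MeasurableSet (Metric.closedBall (0 : E d) (2 * R))ᶜ := measurableSet_closedBall.compl
  set s := (Metric.closedBall (0 : E d) (2 * R))ᶜ with hsdef
  calc ∫⁻ x in s, ‖x‖ₑ * smoothDensity K P x
      = ∫⁻ x, s.indicator (fun x ↦ ‖x‖ₑ) x * smoothDensity K P x := by
        rw [← lintegral_indicator hs]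
        refine lintegral_congr fun x ↦ ?_
        by_cases hx : x ∈ s <;> simp [hx]
    _ = ∫⁻ y, ∫⁻ x, s.indicator (fun x ↦ ‖x‖ₑ) x * K (x - y) ∂volume ∂P :=
        lintegral_mul_smoothDensity hK (measurable_enorm.indicator hs) P
    _ ≤ ∫⁻ y, ∫⁻ x, 2 * (‖x - y‖ₑ * K (x - y)) ∂volume ∂P := by
        refine lintegral_mono_ae ?_
        filter_upwards [hP] with y hy
        refine lintegral_mono fun x ↦ ?_
        rw [← mul_assoc]
        gcongr
        by_cases hx : x ∈ s
        · rw [indicator_of_mem hx]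
          have h2 : 2 * R < ‖x‖ := by simpa [hsdef] using hx
          have h3 : ‖x‖ ≤ 2 * ‖x - y‖ := by
            have := norm_sub_norm_le x y
            linarith
          have h4 := ENNReal.ofReal_le_ofReal h3
          rwa [ENNReal.ofReal_mul (by norm_num), ENNReal.ofReal_ofNat, ofReal_norm,
            ofReal_norm] at h4
        · simp [hx]
    _ = 2 * ∫⁻ z, ‖z‖ₑ * K z := by
        have : ∀ y, ∫⁻ x, 2 * (‖x - y‖ₑ * K (x - y)) = 2 * ∫⁻ z, ‖z‖ₑ * K z := by
          intro y
          rw [lintegral_sub_right_eq_self (fun z ↦ 2 * (‖z‖ₑ * K z)) y,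
            lintegral_const_mul _ (by fun_prop)]
        simp [this]

/-- Two measures supported in a ball are close in Wasserstein distance as soon as the densities of
their convolutions with a concentrated kernel are uniformly close. -/
theorem W1_le_of_smoothDensity_le {K : E d → ℝ≥0∞} (hK : Measurable K) (hK1 : ∫⁻ z, K z = 1)
    (P Q : ProbabilityMeasure (E d)) {R : ℝ}
    (hP : ∀ᵐ y ∂(P : Measure (E d)), ‖y‖ ≤ R) (hQ : ∀ᵐ y ∂(Q : Measure (E d)), ‖y‖ ≤ R)
    {M : ℝ≥0∞} (hM : ∀ x, (smoothDensity K P x - smoothDensity K Q x) +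
      (smoothDensity K Q x - smoothDensity K P x) ≤ M) :
    W1 P Q ≤ 6 * (∫⁻ z, ‖z‖ₑ * K z) +
      ENNReal.ofReal (2 * R) * M * volume (Metric.closedBall (0 : E d) (2 * R)) := by
  set m := ∫⁻ z, ‖z‖ₑ * K z with hm
  let P' : ProbabilityMeasure (E d) :=
    ⟨volume.withDensity (smoothDensity K P), isProbabilityMeasure_smoothDensity hK hK1 P⟩
  let Q' : ProbabilityMeasure (E d) :=
    ⟨volume.withDensity (smoothDensity K Q), isProbabilityMeasure_smoothDensity hK hK1 Q⟩
  have h1 : W1 P P' ≤ m := W1_smoothDensity_le hK hK1 P P' rfl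
  have h2 : W1 Q' Q ≤ m := W1_comm Q Q' ▸ W1_smoothDensity_le hK hK1 Q Q' rfl
  have hqP := measurable_smoothDensity hK (P : Measure (E d))
  have hqQ := measurable_smoothDensity hK (Q : Measure (E d))
  have h3 := W1_withDensity_le (P := P') (Q := Q') volume hqP hqQ rfl rfl
  rw [← lintegral_add_compl _ (measurableSet_closedBall (x := (0 : E d)) (ε := 2 * R))] at h3
  have h4 : ∫⁻ x in Metric.closedBall (0 : E d) (2 * R),
      ‖x‖ₑ * ((smoothDensity K P x - smoothDensity K Q x) +
        (smoothDensity K Q x - smoothDensity K P x)) ≤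
      ENNReal.ofReal (2 * R) * M * volume (Metric.closedBall (0 : E d) (2 * R)) := by
    rw [← setLIntegral_const]
    refine setLIntegral_mono measurable_const fun x hx ↦ ?_
    gcongr
    · rw [← ofReal_norm]
      exact ENNReal.ofReal_le_ofReal (by simpa using hx)
    · exact hM x
  have h5 : ∫⁻ x in (Metric.closedBall (0 : E d) (2 * R))ᶜ,
      ‖x‖ₑ * ((smoothDensity K P x - smoothDensity K Q x) +
        (smoothDensity K Q x - smoothDensity K P x)) ≤ 2 * m + 2 * m := by
    calc _ ≤ ∫⁻ x in (Metric.closedBall (0 : E d) (2 * R))ᶜ,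
          (‖x‖ₑ * smoothDensity K P x + ‖x‖ₑ * smoothDensity K Q x) := by
          refine lintegral_mono fun x ↦ ?_
          rw [← mul_add]
          gcongr <;> exact tsub_le_self
      _ ≤ _ := by
          rw [lintegral_add_left (by fun_prop)]
          exact add_le_add (setLIntegral_smoothDensity_le hK P hP)
            (setLIntegral_smoothDensity_le hK Q hQ)
  -- The factor 6 collects one `m` for smoothing each measure and `2 * m` for the tail of each
  -- smoothed density.
  calc W1 P Q ≤ W1 P P' + (W1 P' Q' + W1 Q' Q) :=
        (W1_triangle P P' Q).trans (by gcongr; exact W1_triangle P' Q' Q)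
    _ ≤ m + ((ENNReal.ofReal (2 * R) * M * volume (Metric.closedBall (0 : E d) (2 * R)) +
          (2 * m + 2 * m)) + m) := by
        gcongr
        exact h3.trans (add_le_add h4 h5)
    _ = _ := by ring

theorem W1_le_two_mul (P Q : ProbabilityMeasure (E d)) {R : ℝ}
    (hP : ∀ᵐ y ∂(P : Measure (E d)), ‖y‖ ≤ R) (hQ : ∀ᵐ y ∂(Q : Measure (E d)), ‖y‖ ≤ R) :
    W1 P Q ≤ ENNReal.ofReal (2 * R) := by
  refine (W1_le_of_coupling ((P : Measure (E d)).prod Q) (by simp) (by simp)).trans ?_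
  calc _ ≤ ∫⁻ _, ENNReal.ofReal (2 * R) ∂((P : Measure (E d)).prod (Q : Measure (E d))) := by
        refine lintegral_mono_ae ?_
        have h1 := (Measure.quasiMeasurePreserving_fst
          (μ := (P : Measure (E d))) (ν := (Q : Measure (E d)))).ae hP
        have h2 := (Measure.quasiMeasurePreserving_snd
          (μ := (P : Measure (E d))) (ν := (Q : Measure (E d)))).ae hQ
        filter_upwards [h1, h2] with z hz1 hz2
        rw [edist_dist, dist_eq_norm]
        refine ENNReal.ofReal_le_ofReal ((norm_sub_le _ _).trans ?_)
        linarith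
    _ = _ := by simp

/-! ### Gaussian moments and the Gaussian kernel -/

theorem rpow_mul_exp_neg_sq_le {s : ℝ} (hs : 0 ≤ s) :
    ∃ K : ℝ, ∀ x : ℝ, 0 ≤ x → x ^ s * Real.exp (-x ^ 2) ≤ K * Real.exp (-(1 / 2) * x ^ 2) := by
  obtain ⟨n, hn⟩ := exists_nat_ge s
  refine ⟨n.factorial * Real.exp 2, fun x hx ↦ ?_⟩
  have h1 : x ^ s ≤ (1 + x) ^ n := by
    rw [← Real.rpow_natCast]
    exact (Real.rpow_le_rpow hx (by linarith) hs).trans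
      (Real.rpow_le_rpow_of_exponent_le (by linarith) hn)
  have h2 : (1 + x) ^ n ≤ n.factorial * Real.exp (1 + x) := by
    have := Real.pow_div_factorial_le_exp (1 + x) (by linarith) n
    rwa [div_le_iff₀' (by positivity)] at this
  calc x ^ s * Real.exp (-x ^ 2)
      ≤ (n.factorial * Real.exp (1 + x)) * Real.exp (-x ^ 2) := by
        gcongr
        exact h1.trans h2
    _ = n.factorial * Real.exp (1 + x + -x ^ 2) := by rw [mul_assoc, ← Real.exp_add]
    _ ≤ n.factorial * Real.exp (2 + -(1 / 2) * x ^ 2) := by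
        refine mul_le_mul_of_nonneg_left (Real.exp_le_exp.2 ?_) (by positivity)
        nlinarith [sq_nonneg (x - 1)]
    _ = _ := by rw [Real.exp_add, mul_assoc]

theorem integrable_exp_neg_mul_sq_norm {b : ℝ} (hb : 0 < b) :
    Integrable fun x : E d ↦ Real.exp (-b * ‖x‖ ^ 2) := by
  have h := GaussianFourier.integrable_cexp_neg_mul_sq_norm_add (V := E d) (b := b)
    (by simpa using hb) 0 0
  refine h.norm.congr (ae_of_all _ fun x ↦ ?_)
  simp only [Complex.norm_exp]
  norm_cast
  simp

theorem integrable_norm_rpow_mul_exp_neg_sq {s : ℝ} (hs : 0 ≤ s) :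
    Integrable fun x : E d ↦ ‖x‖ ^ s * Real.exp (-‖x‖ ^ 2) := by
  obtain ⟨K, hK⟩ := rpow_mul_exp_neg_sq_le hs
  refine ((integrable_exp_neg_mul_sq_norm (d := d) (b := 1 / 2) (by norm_num)).const_mul K).mono'
    (by fun_prop) (ae_of_all _ fun x ↦ ?_)
  rw [Real.norm_of_nonneg (by positivity)]
  exact hK _ (norm_nonneg x)

/-- The moment of order `s` of the weight `exp (-‖x‖ ^ 2)`. -/
noncomputable def gaussMoment (d : ℕ) (s : ℝ) : ℝ := ∫ x : E d, ‖x‖ ^ s * Real.exp (-‖x‖ ^ 2)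

theorem gaussMoment_nonneg (d : ℕ) (s : ℝ) : 0 ≤ gaussMoment d s :=
  integral_nonneg fun x ↦ by positivity

theorem norm_rpow_mul_exp_neg_mul_sq_eq {s δ : ℝ} (hδ : 0 < δ) (x : E d) :
    ‖x‖ ^ s * Real.exp (-(δ ^ 2) * ‖x‖ ^ 2) =
      δ ^ (-s) * (‖δ • x‖ ^ s * Real.exp (-‖δ • x‖ ^ 2)) := by
  rw [norm_smul, Real.norm_of_nonneg hδ.le, Real.mul_rpow hδ.le (norm_nonneg x), ← mul_assoc,
    ← mul_assoc, ← Real.rpow_add hδ]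
  simp [mul_pow]

theorem integrable_norm_rpow_mul_exp_neg_mul_sq {s δ : ℝ} (hs : 0 ≤ s) (hδ : 0 < δ) :
    Integrable fun x : E d ↦ ‖x‖ ^ s * Real.exp (-(δ ^ 2) * ‖x‖ ^ 2) := by
  simp_rw [norm_rpow_mul_exp_neg_mul_sq_eq hδ]
  exact ((integrable_norm_rpow_mul_exp_neg_sq hs).comp_smul hδ.ne').const_mul _

/-- The substitution `x ↦ δ • x`. This scaling is the source of the exponents `d + β` and `d + p`.
-/
theorem integral_norm_rpow_mul_exp_neg_mul_sq {s δ : ℝ} (hδ : 0 < δ) :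
    ∫ x : E d, ‖x‖ ^ s * Real.exp (-(δ ^ 2) * ‖x‖ ^ 2) = δ ^ (-(d + s)) * gaussMoment d s := by
  simp_rw [norm_rpow_mul_exp_neg_mul_sq_eq hδ]
  rw [integral_const_mul,
    Measure.integral_comp_smul_of_nonneg volume
      (fun x : E d ↦ ‖x‖ ^ s * Real.exp (-‖x‖ ^ 2)) δ (hR := hδ.le),
    finrank_euclideanSpace_fin, smul_eq_mul, ← mul_assoc, gaussMoment, neg_add, Real.rpow_add hδ,
    Real.rpow_neg hδ.le (d : ℝ), Real.rpow_natCast, mul_comm (δ ^ (-s))]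

/-- The centred Gaussian density on `ℝ^d` with covariance `2 δ² I`. -/
noncomputable def gaussKernel (δ : ℝ) (w : E d) : ℝ :=
  (∫ v : E d, Real.exp (-(1 / 4) * ‖v‖ ^ 2))⁻¹ * ((δ ^ d)⁻¹ *
    Real.exp (-(1 / 4) * ‖δ⁻¹ • w‖ ^ 2))

theorem integral_exp_neg_quarter_pos (d : ℕ) :
    0 < ∫ v : E d, Real.exp (-(1 / 4) * ‖v‖ ^ 2) := by
  rw [GaussianFourier.integral_rexp_neg_mul_sq_norm (by norm_num)]
  positivity

theorem gaussKernel_nonneg {δ : ℝ} (hδ : 0 < δ) (w : E d) : 0 ≤ gaussKernel δ w := by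
  have := integral_exp_neg_quarter_pos d
  unfold gaussKernel
  positivity

theorem continuous_gaussKernel (δ : ℝ) : Continuous (gaussKernel (d := d) δ) := by
  unfold gaussKernel
  fun_prop

theorem integrable_gaussKernel {δ : ℝ} (hδ : 0 < δ) : Integrable (gaussKernel (d := d) δ) :=
  (((integrable_exp_neg_mul_sq_norm (d := d) (b := 1 / 4) (by norm_num)).comp_smul
    (inv_ne_zero hδ.ne')).const_mul _).const_mul _

theorem integral_gaussKernel {δ : ℝ} (hδ : 0 < δ) : ∫ w : E d, gaussKernel δ w = 1 := by
  have := integral_exp_neg_quarter_pos d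
  unfold gaussKernel
  rw [integral_const_mul, integral_const_mul,
    Measure.integral_comp_inv_smul_of_nonneg volume
      (fun x : E d ↦ Real.exp (-(1 / 4) * ‖x‖ ^ 2)) hδ.le, finrank_euclideanSpace_fin, smul_eq_mul,
    inv_mul_cancel_left₀ (by positivity), inv_mul_cancel₀ this.ne']

theorem integrable_norm_mul_gaussKernel {δ : ℝ} (hδ : 0 < δ) :
    Integrable fun w : E d ↦ ‖w‖ * gaussKernel δ w := by
  have h := (integrable_norm_rpow_mul_exp_neg_mul_sq (d := d) zero_le_one
    (δ := (2 * δ)⁻¹) (by positivity)).const_mul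
    ((∫ v : E d, Real.exp (-(1 / 4) * ‖v‖ ^ 2))⁻¹ * (δ ^ d)⁻¹)
  refine h.congr (ae_of_all _ fun w ↦ ?_)
  simp only [gaussKernel, Real.rpow_one, norm_smul, norm_inv, Real.norm_of_nonneg hδ.le]
  rw [show -(1 / 4) * (δ⁻¹ * ‖w‖) ^ 2 = -((2 * δ)⁻¹ ^ 2) * ‖w‖ ^ 2 by field_simp; ring]
  ring

theorem integral_norm_mul_gaussKernel {δ : ℝ} (hδ : 0 < δ) :
    ∫ w : E d, ‖w‖ * gaussKernel δ w = δ * ∫ w : E d, ‖w‖ * gaussKernel 1 w := by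
  have h : ∀ w : E d, ‖w‖ * gaussKernel δ w =
      (δ ^ d)⁻¹ * (δ * (‖δ⁻¹ • w‖ * gaussKernel 1 (δ⁻¹ • w))) := by
    intro w
    simp only [gaussKernel, norm_smul, norm_inv, Real.norm_of_nonneg hδ.le]
    field_simp
    simp
  simp_rw [h]
  rw [integral_const_mul, integral_const_mul,
    Measure.integral_comp_inv_smul_of_nonneg volume
      (fun w : E d ↦ ‖w‖ * gaussKernel 1 w) hδ.le, finrank_euclideanSpace_fin, smul_eq_mul]
  field_simp

theorem lintegral_gaussKernel {δ : ℝ} (hδ : 0 < δ) :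
    ∫⁻ w : E d, ENNReal.ofReal (gaussKernel δ w) = 1 := by
  rw [← ofReal_integral_eq_lintegral_ofReal (integrable_gaussKernel hδ)
    (ae_of_all _ fun w ↦ gaussKernel_nonneg hδ w), integral_gaussKernel hδ, ENNReal.ofReal_one]

theorem lintegral_enorm_mul_gaussKernel {δ : ℝ} (hδ : 0 < δ) :
    ∫⁻ w : E d, ‖w‖ₑ * ENNReal.ofReal (gaussKernel δ w) =
      ENNReal.ofReal (δ * ∫ w : E d, ‖w‖ * gaussKernel 1 w) := by
  rw [← integral_norm_mul_gaussKernel hδ, ofReal_integral_eq_lintegral_ofReal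
    (integrable_norm_mul_gaussKernel hδ)
    (ae_of_all _ fun w ↦ mul_nonneg (norm_nonneg w) (gaussKernel_nonneg hδ w))]
  refine lintegral_congr fun w ↦ ?_
  rw [ENNReal.ofReal_mul (norm_nonneg w), ofReal_norm]

/-! ### Fourier inversion for smoothed measures -/

/-- The Gaussian density is a Gaussian superposition of characters. -/
theorem exists_gaussKernel_eq_integral (d : ℕ) : ∃ κ : ℝ, 0 < κ ∧ ∀ δ : ℝ, 0 < δ → ∀ w : E d,
    (gaussKernel δ w : ℂ) = κ * ∫ u : E d,
      Complex.exp (-((δ ^ 2 : ℝ) : ℂ) * ‖u‖ ^ 2 + Complex.I * (inner ℝ w u : ℝ)) := by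
  have hZ := integral_exp_neg_quarter_pos d
  -- The Gaussian integral equals `(π / δ²)^(d/2)` times the exponential in `gaussKernel`. Its power
  -- of `δ` is already part of the kernel, so `κ` does not depend on `δ`.
  refine ⟨(∫ v : E d, Real.exp (-(1 / 4) * ‖v‖ ^ 2))⁻¹ * (Real.pi ^ (d / 2 : ℝ))⁻¹,
    by positivity, fun δ hδ w ↦ ?_⟩
  rw [GaussianFourier.integral_cexp_neg_mul_sq_norm_add
    (by rw [Complex.ofReal_re]; positivity), finrank_euclideanSpace_fin]
  have h1 : ((Real.pi : ℂ) / ((δ ^ 2 : ℝ) : ℂ)) ^ (d / 2 : ℂ) =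
      ((Real.pi ^ (d / 2 : ℝ) * (δ ^ d)⁻¹ : ℝ) : ℂ) := by
    have : (Real.pi / δ ^ 2) ^ (d / 2 : ℝ) = Real.pi ^ (d / 2 : ℝ) * (δ ^ d)⁻¹ := by
      rw [Real.div_rpow Real.pi_pos.le (by positivity), div_eq_mul_inv, ← Real.rpow_natCast δ 2,
        ← Real.rpow_mul hδ.le, ← Real.rpow_natCast δ d]
      congr 3
      push_cast
      ring
    rw [← this, Complex.ofReal_cpow (by positivity)]
    push_cast
    rfl
  have h2 : Complex.exp (Complex.I ^ 2 * (‖w‖ : ℂ) ^ 2 / (4 * ((δ ^ 2 : ℝ) : ℂ))) =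
      ((Real.exp (-(1 / 4) * ‖δ⁻¹ • w‖ ^ 2) : ℝ) : ℂ) := by
    rw [Complex.ofReal_exp, norm_smul, norm_inv, Real.norm_of_nonneg hδ.le, Complex.I_sq]
    congr 1
    push_cast
    field_simp
  rw [h1, h2]
  norm_cast
  unfold gaussKernel
  field_simp

theorem integrable_gaussKernel_sub {δ : ℝ} (hδ : 0 < δ) (P : Measure (E d))
    [IsProbabilityMeasure P] (x : E d) : Integrable (fun y ↦ gaussKernel δ (x - y)) P := by
  have hZ := integral_exp_neg_quarter_pos d
  refine Integrable.of_bound ((continuous_gaussKernel δ).comp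
    (continuous_const.sub continuous_id)).aestronglyMeasurable
    ((∫ v : E d, Real.exp (-(1 / 4) * ‖v‖ ^ 2))⁻¹ * ((δ ^ d)⁻¹ * 1))
    (ae_of_all _ fun y ↦ ?_)
  rw [Real.norm_of_nonneg (gaussKernel_nonneg hδ _)]
  unfold gaussKernel
  gcongr
  exact Real.exp_le_one_iff.2 (by nlinarith [sq_nonneg ‖δ⁻¹ • (x - y)‖])

theorem smoothDensity_gaussKernel {δ : ℝ} (hδ : 0 < δ) (P : Measure (E d))
    [IsProbabilityMeasure P] (x : E d) :
    smoothDensity (fun w ↦ ENNReal.ofReal (gaussKernel δ w)) P x =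
      ENNReal.ofReal (∫ y, gaussKernel δ (x - y) ∂P) :=
  (ofReal_integral_eq_lintegral_ofReal (integrable_gaussKernel_sub hδ P x)
    (ae_of_all _ fun _ ↦ gaussKernel_nonneg hδ _)).symm

theorem norm_cexp_neg_mul_sq_add (b : ℝ) (w u : E d) :
    ‖Complex.exp (-(b : ℂ) * ‖u‖ ^ 2 + Complex.I * (inner ℝ w u : ℝ))‖ =
      Real.exp (-b * ‖u‖ ^ 2) := by
  rw [Complex.norm_exp]
  simp [← Complex.ofReal_pow, ← Complex.ofReal_neg]

theorem integral_cexp_eq_charFun {b : ℝ} (hb : 0 < b) (P : Measure (E d))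
    [IsProbabilityMeasure P] (x : E d) :
    ∫ y, (∫ u : E d,
        Complex.exp (-(b : ℂ) * ‖u‖ ^ 2 + Complex.I * (inner ℝ (x - y) u : ℝ))) ∂P =
      ∫ u : E d, Complex.exp (-(b : ℂ) * ‖u‖ ^ 2 + Complex.I * (inner ℝ x u : ℝ)) *
        charFun P (-u) := by
  rw [integral_integral_swap]
  · refine integral_congr_ae (ae_of_all _ fun u ↦ ?_)
    simp only [charFun_apply]
    rw [← integral_const_mul]
    refine integral_congr_ae (ae_of_all _ fun y ↦ ?_)
    simp only
    rw [← Complex.exp_add, inner_sub_left, inner_neg_right]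
    congr 1
    push_cast
    ring
  · have h : Integrable (fun z : E d × E d ↦ (1 : ℝ) * Real.exp (-b * ‖z.2‖ ^ 2))
        (P.prod volume) :=
      (integrable_const (1 : ℝ)).mul_prod (integrable_exp_neg_mul_sq_norm hb)
    refine h.mono' (by unfold Function.uncurry; fun_prop) (ae_of_all _ fun z ↦ ?_)
    simp only [Function.uncurry, one_mul]
    rw [norm_cexp_neg_mul_sq_add]

/-- By Fubini, a smoothed density is the integral of `charFun` against a character with Gaussian
damping. Taking absolute values removes the dependence on `x` and leaves one Gaussian moment per
term of the bound. -/
theorem exists_abs_integral_gaussKernel_sub_le (d : ℕ) : ∃ κ : ℝ, 0 < κ ∧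
    ∀ (P Q : Measure (E d)) [IsProbabilityMeasure P] [IsProbabilityMeasure Q]
      (a b c β p δ : ℝ), 0 ≤ β → 0 ≤ p → 0 < δ →
      (∀ u, ‖charFun P u - charFun Q u‖ ≤ a + b * ‖u‖ ^ β + c * ‖u‖ ^ p) →
      ∀ x, |∫ y, gaussKernel δ (x - y) ∂P - ∫ y, gaussKernel δ (x - y) ∂Q| ≤
        κ * (a * (δ ^ (-(d + 0 : ℝ)) * gaussMoment d 0) +
          b * (δ ^ (-(d + β)) * gaussMoment d β) + c * (δ ^ (-(d + p)) * gaussMoment d p)) := by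
  obtain ⟨κ, hκ, hrep⟩ := exists_gaussKernel_eq_integral d
  refine ⟨κ, hκ, fun P Q _ _ a b c β p δ hβ hp hδ hab x ↦ ?_⟩
  have hδ2 : 0 < δ ^ 2 := by positivity
  have key : ∀ (S : Measure (E d)) [IsProbabilityMeasure S],
      ((∫ y, gaussKernel δ (x - y) ∂S : ℝ) : ℂ) = κ * ∫ u : E d,
        Complex.exp (-((δ ^ 2 : ℝ) : ℂ) * ‖u‖ ^ 2 + Complex.I * (inner ℝ x u : ℝ)) *
          charFun S (-u) := by
    intro S _
    rw [← integral_cexp_eq_charFun hδ2, ← integral_const_mul, ← integral_complex_ofReal]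
    simp_rw [hrep δ hδ]
  have hint : ∀ (S : Measure (E d)) [IsProbabilityMeasure S], Integrable fun u : E d ↦
      Complex.exp (-((δ ^ 2 : ℝ) : ℂ) * ‖u‖ ^ 2 + Complex.I * (inner ℝ x u : ℝ)) *
          charFun S (-u) := by
    intro S _
    have hm : Measurable fun u : E d ↦ charFun S (-u) := measurable_charFun.comp measurable_neg
    refine (integrable_exp_neg_mul_sq_norm (d := d) hδ2).mono' (by fun_prop)
      (ae_of_all _ fun u ↦ ?_)
    rw [norm_mul, norm_cexp_neg_mul_sq_add]
    exact mul_le_of_le_one_right (Real.exp_pos _).le (norm_charFun_le_one _)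
  rw [← Real.norm_eq_abs, ← Complex.norm_real, Complex.ofReal_sub, key P, key Q, ← mul_sub,
    ← integral_sub (hint P) (hint Q), norm_mul, Complex.norm_real, Real.norm_of_nonneg hκ.le]
  gcongr
  have i0 := (integrable_norm_rpow_mul_exp_neg_mul_sq (d := d) le_rfl hδ).const_mul a
  have i1 := (integrable_norm_rpow_mul_exp_neg_mul_sq (d := d) hβ hδ).const_mul b
  have i2 := (integrable_norm_rpow_mul_exp_neg_mul_sq (d := d) hp hδ).const_mul c
  rw [← integral_norm_rpow_mul_exp_neg_mul_sq hδ, ← integral_norm_rpow_mul_exp_neg_mul_sq hδ,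
    ← integral_norm_rpow_mul_exp_neg_mul_sq hδ, ← integral_const_mul, ← integral_const_mul,
    ← integral_const_mul, ← integral_add i0 i1, ← integral_add (f := fun u ↦ _ + _) (i0.add i1) i2]
  refine norm_integral_le_of_norm_le ((i0.add i1).add i2) (ae_of_all _ fun u ↦ ?_)
  rw [← mul_sub, norm_mul, norm_cexp_neg_mul_sq_add]
  have := hab (-u)
  rw [norm_neg] at this
  simp only [Real.rpow_zero]
  nlinarith [Real.exp_pos (-(δ ^ 2) * ‖u‖ ^ 2)]

/-! ### Fourier transforms of mixtures and deconvolution -/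

theorem integrable_comp_sub_prod {g : E d → ℝ} (hgm : Measurable g) (hg : Integrable g)
    (P : Measure (E d)) [IsProbabilityMeasure P] :
    Integrable (fun z : E d × E d ↦ g (z.1 - z.2)) (volume.prod P) := by
  have hm : Measurable fun z : E d × E d ↦ g (z.1 - z.2) := by fun_prop
  rw [integrable_prod_iff' hm.aestronglyMeasurable]
  refine ⟨ae_of_all _ fun y ↦ hg.comp_sub_right y, ?_⟩
  have : ∀ y, ∫ x, ‖g (x - y)‖ = ∫ x, ‖g x‖ := fun y ↦
    integral_sub_right_eq_self (fun x ↦ ‖g x‖) y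
  simp only [this]
  exact integrable_const _

/-- The convolution theorem: exchange the integrals, then translate `x` by `θ`. -/
theorem integral_cexp_mul_integral_sub {g : E d → ℝ} (hgm : Measurable g) (hg : Integrable g)
    (P : Measure (E d)) [IsProbabilityMeasure P] (ξ : E d) :
    ∫ x, Complex.exp (Complex.I * (inner ℝ ξ x : ℝ)) * ((∫ θ, g (x - θ) ∂P : ℝ) : ℂ) =
      charFun P ξ * ∫ x, Complex.exp (Complex.I * (inner ℝ ξ x : ℝ)) * (g x : ℂ) := by
  have hint : Integrable (Function.uncurry fun x θ ↦
      Complex.exp (Complex.I * (inner ℝ ξ x : ℝ)) * (g (x - θ) : ℂ)) (volume.prod P) := by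
    refine (integrable_comp_sub_prod hgm hg P).mono (by fun_prop) (ae_of_all _ fun z ↦ ?_)
    simp [Function.uncurry, Complex.norm_exp]
  have hl : ∀ x, Complex.exp (Complex.I * (inner ℝ ξ x : ℝ)) * ((∫ θ, g (x - θ) ∂P : ℝ) : ℂ) =
      ∫ θ, Complex.exp (Complex.I * (inner ℝ ξ x : ℝ)) * (g (x - θ) : ℂ) ∂P := fun x ↦ by
    rw [← integral_complex_ofReal, ← integral_const_mul]
  simp_rw [hl]
  rw [integral_integral_swap hint, charFun_apply, ← integral_mul_const]
  refine integral_congr_ae (ae_of_all _ fun θ ↦ ?_)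
  simp only
  rw [← integral_add_right_eq_self _ θ, ← integral_const_mul]
  refine integral_congr_ae (ae_of_all _ fun x ↦ ?_)
  simp only [add_sub_cancel_right]
  rw [inner_add_right, ← mul_assoc, ← Complex.exp_add, real_inner_comm ξ θ]
  congr 2
  push_cast
  ring

theorem IsDensityKernel.integrable {lmin lmax : ℝ} {f : E d → E d → Mat d → ℝ}
    (hf : IsDensityKernel lmin lmax f) {S : Mat d} (hS : S ∈ scaleSet d lmin lmax) :
    Integrable fun x ↦ f x 0 S := by
  refine ⟨(hf.measurable S hS 0).aestronglyMeasurable, ?_⟩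
  rw [hasFiniteIntegral_iff_ofReal (ae_of_all _ fun x ↦ hf.nonneg S hS x 0),
    hf.lintegral_eq_one S hS 0]
  exact ENNReal.one_lt_top

theorem mixDensity_eq {lmin lmax : ℝ} {f : E d → E d → Mat d → ℝ}
    (hf : IsDensityKernel lmin lmax f) {G : ProbabilityMeasure (E d) × Mat d}
    (hS : G.2 ∈ scaleSet d lmin lmax) :
    mixDensity f G = fun x ↦ ∫ θ, f (x - θ) 0 G.2 ∂(G.1 : Measure (E d)) := by
  ext x
  simp only [mixDensity]
  simp_rw [hf.translation G.2 hS x]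

theorem integrable_mixDensity {lmin lmax : ℝ} {f : E d → E d → Mat d → ℝ}
    (hf : IsDensityKernel lmin lmax f) {G : ProbabilityMeasure (E d) × Mat d}
    (hS : G.2 ∈ scaleSet d lmin lmax) : Integrable (mixDensity f G) := by
  rw [mixDensity_eq hf hS]
  exact (integrable_comp_sub_prod (hf.measurable _ hS 0) (hf.integrable hS)
    (G.1 : Measure (E d))).integral_prod_left

theorem integral_cexp_mul_mixDensity {lmin lmax : ℝ} {f : E d → E d → Mat d → ℝ}
    (hf : IsDensityKernel lmin lmax f) {G : ProbabilityMeasure (E d) × Mat d}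
    (hS : G.2 ∈ scaleSet d lmin lmax) (ξ : E d) :
    ∫ x, Complex.exp (Complex.I * (inner ℝ ξ x : ℝ)) * (mixDensity f G x : ℂ) =
      charFun (G.1 : Measure (E d)) ξ * kernelCharFun f G.2 ξ := by
  rw [mixDensity_eq hf hS]
  exact integral_cexp_mul_integral_sub (hf.measurable _ hS 0) (hf.integrable hS) _ ξ

theorem norm_charFun_mul_sub_le_l1Dist {lmin lmax : ℝ} {f : E d → E d → Mat d → ℝ}
    (hf : IsDensityKernel lmin lmax f) {G G' : ProbabilityMeasure (E d) × Mat d}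
    (hS : G.2 ∈ scaleSet d lmin lmax) (hS' : G'.2 ∈ scaleSet d lmin lmax) (ξ : E d) :
    ‖charFun (G.1 : Measure (E d)) ξ * kernelCharFun f G.2 ξ -
      charFun (G'.1 : Measure (E d)) ξ * kernelCharFun f G'.2 ξ‖ ≤
      (l1Dist (mixDensity f G) (mixDensity f G')).toReal := by
  have hG := integrable_mixDensity hf hS
  have hG' := integrable_mixDensity hf hS'
  have hint : ∀ {g : E d → ℝ}, Integrable g →
      Integrable fun x ↦ Complex.exp (Complex.I * (inner ℝ ξ x : ℝ)) * (g x : ℂ) := by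
    intro g hg
    refine hg.mono ((by fun_prop : AEStronglyMeasurable _ volume).mul
      (Complex.continuous_ofReal.comp_aestronglyMeasurable hg.1)) (ae_of_all _ fun x ↦ ?_)
    simp [Complex.norm_exp]
  rw [← integral_cexp_mul_mixDensity hf hS, ← integral_cexp_mul_mixDensity hf hS',
    ← integral_sub (hint hG) (hint hG'), l1Dist, eLpNorm_one_eq_lintegral_enorm,
    ← integral_norm_eq_lintegral_enorm (f := fun x ↦ mixDensity f G x - mixDensity f G' x)
      (hG.sub hG').1]
  refine norm_integral_le_of_norm_le (hG.sub hG').norm (ae_of_all _ fun x ↦ le_of_eq ?_)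
  rw [← mul_sub, ← Complex.ofReal_sub, norm_mul, Complex.norm_exp, Complex.norm_real]
  simp

theorem l1Dist_mixDensity_ne_top {lmin lmax : ℝ} {f : E d → E d → Mat d → ℝ}
    (hf : IsDensityKernel lmin lmax f) {G G' : ProbabilityMeasure (E d) × Mat d}
    (hS : G.2 ∈ scaleSet d lmin lmax) (hS' : G'.2 ∈ scaleSet d lmin lmax) :
    l1Dist (mixDensity f G) (mixDensity f G') ≠ ∞ := by
  rw [l1Dist, eLpNorm_one_eq_lintegral_enorm]
  exact ((integrable_mixDensity hf hS).sub (integrable_mixDensity hf hS')).2.ne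

/-- Deconvolution: dividing by the larger of the two factors `z`, `z'` recovers the distance of
`a` and `a'` from the distance of the products. -/
theorem norm_sub_le_of_norm_mul_sub_le {a a' z z' : ℂ} {L X r : ℝ} (ha : ‖a‖ ≤ 1) (ha' : ‖a'‖ ≤ 1)
    (hr : 0 < r) (hz : r ≤ ‖z‖) (hz' : r ≤ ‖z'‖)
    (h : ‖a * z - a' * z'‖ ≤ L) (hX : ‖z' - z‖ ≤ X * max ‖z'‖ ‖z‖) :
    ‖a - a'‖ ≤ L * r⁻¹ + X := by
  have hL : 0 ≤ L := (norm_nonneg _).trans h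
  -- `M` stands for the larger of the two moduli, so the relative error `X` survives division
  -- unchanged while `L` only needs `r ≤ M`.
  have main : ∀ M : ℝ, r ≤ M → ‖a - a'‖ * M ≤ L + X * M → ‖a - a'‖ ≤ L * r⁻¹ + X := by
    intro M hM hle
    have hM0 : 0 < M := hr.trans_le hM
    have h1 : ‖a - a'‖ ≤ L * M⁻¹ + X := by
      rw [← mul_le_mul_iff_left₀ hM0, add_mul, inv_mul_cancel_right₀ hM0.ne']
      exact hle
    have h2 : M⁻¹ ≤ r⁻¹ := inv_anti₀ hr hM
    nlinarith
  rcases le_total ‖z'‖ ‖z‖ with hzz | hzz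
  · refine main _ hz ?_
    rw [max_eq_right hzz] at hX
    calc ‖a - a'‖ * ‖z‖ = ‖(a * z - a' * z') + a' * (z' - z)‖ := by
          rw [← norm_mul]; congr 1; ring
      _ ≤ ‖a * z - a' * z'‖ + ‖a'‖ * ‖z' - z‖ := by
          rw [← norm_mul]; exact norm_add_le _ _
      _ ≤ L + 1 * (X * ‖z‖) := by gcongr
      _ = _ := by ring
  · refine main _ hz' ?_
    rw [max_eq_left hzz] at hX
    calc ‖a - a'‖ * ‖z'‖ = ‖(a * z - a' * z') + a * (z' - z)‖ := by
          rw [← norm_mul]; congr 1; ring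
      _ ≤ ‖a * z - a' * z'‖ + ‖a‖ * ‖z' - z‖ := by
          rw [← norm_mul]; exact norm_add_le _ _
      _ ≤ L + 1 * (X * ‖z'‖) := by gcongr
      _ = _ := by ring

theorem norm_charFun_sub_le {lmin lmax : ℝ} {f : E d → E d → Mat d → ℝ}
    (hf : IsDensityKernel lmin lmax f) {p β c₁ c₂ : ℝ} (hc₁ : 0 < c₁) {B : ℝ≥0} {Ξ : ℝ≥0 → ℝ≥0}
    (hΞ : CharFunModulus lmin lmax f p Ξ B) (hsm : OrdinarySmooth lmin lmax f β c₁ c₂)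
    {G G' : ProbabilityMeasure (E d) × Mat d}
    (hS : G.2 ∈ scaleSet d lmin lmax) (hS' : G'.2 ∈ scaleSet d lmin lmax) (ξ : E d) :
    ‖charFun (G.1 : Measure (E d)) ξ - charFun (G'.1 : Measure (E d)) ξ‖ ≤
      (l1Dist (mixDensity f G) (mixDensity f G')).toReal / c₁ * (1 + ‖ξ‖ ^ β) +
        B * Ξ (opNorm (G.2 - G'.2)) * ‖ξ‖ ^ p := by
  have h := norm_sub_le_of_norm_mul_sub_le (norm_charFun_le_one ξ) (norm_charFun_le_one ξ)
    (by positivity) (hsm ξ _ hS).1 (hsm ξ _ hS').1 (norm_charFun_mul_sub_le_l1Dist hf hS hS' ξ)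
    (hΞ ξ _ hS _ hS')
  rwa [mul_inv, inv_inv, ← mul_assoc, ← div_eq_mul_inv] at h

/-! ### From characteristic functions to the Wasserstein distance -/

theorem ae_norm_le_of_support_subset (P : Measure (E d)) {X : Set (E d)} {R : ℝ}
    (hP : P.support ⊆ X) (hX : X ⊆ Metric.closedBall 0 R) : ∀ᵐ y ∂P, ‖y‖ ≤ R := by
  filter_upwards [Measure.support_mem_ae] with y hy
  simpa using hX (hP hy)

/-- Inversion inequality: a polynomially growing bound on the difference of the characteristic
functions controls the Wasserstein distance of measures supported in a ball. -/
theorem exists_W1_rpow_le (d : ℕ) {R β p : ℝ} (hR : 0 < R) (hβ : 0 < β) (hp : 0 ≤ p) :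
    ∃ K₁ K₂ : ℝ, 0 < K₁ ∧ 0 < K₂ ∧ ∀ (P Q : ProbabilityMeasure (E d)) (L X : ℝ), 0 ≤ L → 0 ≤ X →
      (∀ᵐ y ∂(P : Measure (E d)), ‖y‖ ≤ R) → (∀ᵐ y ∂(Q : Measure (E d)), ‖y‖ ≤ R) →
      (∀ u, ‖charFun (P : Measure (E d)) u - charFun (Q : Measure (E d)) u‖ ≤
        L * (1 + ‖u‖ ^ β) + X * ‖u‖ ^ p) →
      (W1 P Q).toReal ^ (d + β + 1) ≤ K₁ * L ∨ (W1 P Q).toReal ^ (d + p + 1) ≤ K₂ * X := by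
  obtain ⟨κ, hκ, hbd⟩ := exists_abs_integral_gaussKernel_sub_le d
  set m := ∫ w : E d, ‖w‖ * gaussKernel 1 w with hm
  have hm0 : 0 ≤ m :=
    integral_nonneg fun w ↦ mul_nonneg (norm_nonneg w) (gaussKernel_nonneg one_pos w)
  set v := (volume (Metric.closedBall (0 : E d) (2 * R))).toReal with hv
  have hv0 : 0 ≤ v := ENNReal.toReal_nonneg
  -- Chosen so that `6 * η * m ≤ 1 / 2`; the summand 1 keeps it well defined when `m = 0`.
  set η := (12 * (m + 1))⁻¹ with hη
  have hη0 : 0 < η := by positivity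
  have hJ0 := gaussMoment_nonneg d 0
  have hJβ := gaussMoment_nonneg d β
  have hJp := gaussMoment_nonneg d p
  set T₁ := 2 * R * v * κ * ((gaussMoment d 0 * (η * (2 * R)) ^ β + gaussMoment d β) *
    η ^ (-(d + β))) with hT₁
  set T₂ := 2 * R * v * κ * (gaussMoment d p * η ^ (-(d + p))) with hT₂
  have hT₁0 : 0 ≤ T₁ := by positivity
  have hT₂0 : 0 ≤ T₂ := by positivity
  -- The factor 4 comes from comparing each term with `W / 4`; the summand 1 ensures positivity,
  -- since `T₁` and `T₂` are only known to be nonnegative.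
  refine ⟨4 * T₁ + 1, 4 * T₂ + 1, by positivity, by positivity,
    fun P Q L X hL hX hP hQ hchar ↦ ?_⟩
  have hWle := W1_le_two_mul P Q hP hQ
  set W := (W1 P Q).toReal with hW
  have hWfin : W1 P Q ≠ ∞ := ne_top_of_le_ne_top ENNReal.ofReal_ne_top hWle
  have hW2R : W ≤ 2 * R := by
    rw [hW, ← ENNReal.toReal_ofReal (by positivity : 0 ≤ 2 * R)]
    exact ENNReal.toReal_mono ENNReal.ofReal_ne_top hWle
  rcases (show 0 ≤ W from ENNReal.toReal_nonneg).eq_or_lt with hW0 | hW0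
  · left
    rw [← hW0, Real.zero_rpow (by positivity)]
    positivity
  -- A width proportional to `W` makes the smoothing cost at most `W / 2`. It must be positive, so
  -- `W = 0` was settled separately.
  set δ := η * W with hδ
  have hδ0 : 0 < δ := by positivity
  set M := κ * (L * (δ ^ (-(d + 0 : ℝ)) * gaussMoment d 0) +
    L * (δ ^ (-(d + β)) * gaussMoment d β) + X * (δ ^ (-(d + p)) * gaussMoment d p)) with hM
  have hM0 : 0 ≤ M := by positivity
  have hbd' := hbd P Q L L X β p δ hβ.le hp hδ0 (fun u ↦ (hchar u).trans_eq (by ring))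
  have hWM := W1_le_of_smoothDensity_le (K := fun w ↦ ENNReal.ofReal (gaussKernel δ w))
    (continuous_gaussKernel δ).measurable.ennreal_ofReal (lintegral_gaussKernel hδ0) P Q hP hQ
    (M := ENNReal.ofReal M) (fun x ↦ by
      have hx := abs_le.1 (hbd' x)
      have hn : ∀ S : ProbabilityMeasure (E d), 0 ≤ ∫ y, gaussKernel δ (x - y) ∂(S : Measure (E d)) :=
        fun S ↦ integral_nonneg fun y ↦ gaussKernel_nonneg hδ0 _
      rw [smoothDensity_gaussKernel hδ0, smoothDensity_gaussKernel hδ0,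
        ← ENNReal.ofReal_sub _ (hn Q), ← ENNReal.ofReal_sub _ (hn P)]
      rcases le_total (∫ y, gaussKernel δ (x - y) ∂(P : Measure (E d)))
        (∫ y, gaussKernel δ (x - y) ∂(Q : Measure (E d))) with h | h
      · rw [ENNReal.ofReal_of_nonpos (sub_nonpos.2 h), zero_add]
        exact ENNReal.ofReal_le_ofReal (by linarith [hx.1])
      · rw [ENNReal.ofReal_of_nonpos (sub_nonpos.2 h), add_zero]
        exact ENNReal.ofReal_le_ofReal hx.2)
  have hWreal : W ≤ 6 * (δ * m) + 2 * R * M * v := by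
    have hvfin : volume (Metric.closedBall (0 : E d) (2 * R)) ≠ ∞ := measure_closedBall_lt_top.ne
    rw [lintegral_enorm_mul_gaussKernel hδ0, ← hm, ← ENNReal.ofReal_toReal hvfin, ← hv,
      ← ENNReal.ofReal_mul (by positivity), ← ENNReal.ofReal_mul (by positivity),
      show (6 : ℝ≥0∞) = ENNReal.ofReal 6 by simp, ← ENNReal.ofReal_mul (by norm_num),
      ← ENNReal.ofReal_add (by positivity) (by positivity)] at hWM
    exact ENNReal.toReal_le_of_le_ofReal (by positivity) hWM
  have hδm : 6 * (δ * m) ≤ W / 2 := by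
    have : η * m ≤ 1 / 12 := by
      rw [hη, inv_mul_le_iff₀ (by positivity)]
      linarith
    rw [hδ]
    nlinarith
  -- The constant 1 in `1 + ‖u‖ ^ β` contributes `δ ^ (-d)`, which is absorbed into `δ ^ (-(d + β))`
  -- because `δ` is bounded.
  have hδβ : δ ^ (-(d + 0 : ℝ)) ≤ (η * (2 * R)) ^ β * δ ^ (-(d + β)) := by
    have : δ ^ (-(d + 0 : ℝ)) = δ ^ β * δ ^ (-(d + β)) := by
      rw [← Real.rpow_add hδ0]
      congr 1
      ring
    have hδle : δ ≤ η * (2 * R) := by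
      rw [hδ]
      gcongr
    rw [this]
    gcongr
  have hMle : 2 * R * M * v ≤ T₁ * L * W ^ (-(d + β)) + T₂ * X * W ^ (-(d + p)) := by
    calc 2 * R * M * v ≤ 2 * R * (κ * (L * ((η * (2 * R)) ^ β * δ ^ (-(d + β)) * gaussMoment d 0) +
          L * (δ ^ (-(d + β)) * gaussMoment d β) + X * (δ ^ (-(d + p)) * gaussMoment d p))) * v := by
          rw [hM]
          gcongr
      _ = _ := by
          rw [hδ, Real.mul_rpow hη0.le hW0.le, Real.mul_rpow hη0.le hW0.le]
          ring
  have hexp : ∀ s : ℝ, W ^ (d + s + 1) = W * W ^ (d + s) := fun s ↦ by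
    rw [Real.rpow_add hW0, Real.rpow_one, mul_comm]
  have hsplit : ∀ T Y s : ℝ, 0 ≤ Y → W / 4 ≤ T * Y * W ^ (-(d + s)) →
      W ^ (d + s + 1) ≤ (4 * T + 1) * Y := by
    intro T Y s hY h
    have hpos : 0 < W ^ (d + s) := by positivity
    rw [Real.rpow_neg hW0.le, ← div_eq_mul_inv, le_div_iff₀ hpos] at h
    rw [hexp]
    linarith
  -- The two terms add up to at least `W / 2`, so one of them is at least `W / 4`.
  rcases le_or_gt (W / 4) (T₁ * L * W ^ (-(d + β))) with h | h
  · exact Or.inl (hsplit _ _ _ hL h)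
  · exact Or.inr (hsplit _ _ _ hX (by linarith))

/-! ### Conclusion -/

/-- `t` competes in the infimum defining `incrInv`, and `extendTop` is monotone; no continuity is
needed. -/
theorem extendTop_incrInv_le {Ψ Ξ : ℝ≥0 → ℝ≥0} (hΨ : StrictMono Ψ) {y : ℝ≥0∞} {t : ℝ≥0}
    (h : y ≤ Ξ t) : extendTop Ψ (incrInv Ξ y) ≤ Ψ t := by
  rw [← extendTop_coe hΨ]
  exact biSup_mono fun s hs ↦ hs.trans (iInf₂_le t h)

end LocScaleMixture

open LocScaleMixture in
theorem theorem3p3 (d : ℕ) (R lmin lmax : ℝ) (hR : 0 < R) (hlmin : 0 < lmin) (hl : lmin < lmax)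
    (β : ℝ) (hβ : 0 < β) (p : ℝ) (hp : 1 ≤ p)
    (c₁ c₂ : ℝ) (hc₁ : 0 < c₁) (hc₂ : 0 < c₂) (A B : ℝ≥0) (hA : 0 < A) (hB : 0 < B) :
    ∃ C C' : ℝ≥0, 0 < C ∧ 0 < C' ∧
      ∀ (X : Set (E d)) (f : E d → E d → Mat d → ℝ) (Ψ Ξ : ℝ≥0 → ℝ≥0),
        MeasurableSet X → X ⊆ Metric.closedBall 0 R →
        IsDensityKernel lmin lmax f →
        StrictMono Ψ → ScaleLowerBound X lmin lmax f Ψ A →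
        StrictMono Ξ → CharFunModulus lmin lmax f p Ξ B →
        OrdinarySmooth lmin lmax f β c₁ c₂ →
        ∀ G ∈ mixingSet X lmin lmax, ∀ G' ∈ mixingSet X lmin lmax,
          (C' : ℝ≥0∞) *
              ((Ψ (opNorm (G.2 - G'.2)) : ℝ≥0∞) +
                min (W1 G.1 G'.1 ^ ((d : ℝ) + β + 1))
                  (extendTop Ψ (incrInv Ξ (C * W1 G.1 G'.1 ^ ((d : ℝ) + p + 1))))) ≤
            l1Dist (mixDensity f G) (mixDensity f G') := by
  obtain ⟨K₁, K₂, hK₁, hK₂, hmain⟩ := exists_W1_rpow_le d hR hβ (zero_le_one.trans hp)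
  have hBr : (0 : ℝ) < B := hB
  -- `A` serves the alternative controlled by `Ψ`, `c₁ / K₁` the one controlled directly by the `L¹`
  -- distance.
  set D : ℝ≥0 := min A (c₁ / K₁).toNNReal with hD
  have hD0 : 0 < D := lt_min hA (Real.toNNReal_pos.2 (by positivity))
  -- `C` turns `W ^ (d+p+1) ≤ K₂ * (B * Ξ t)` into `C * W ^ (d+p+1) ≤ Ξ t`. Halving `D` lets the two
  -- summands be bounded separately.
  refine ⟨(K₂ * B)⁻¹.toNNReal, D / 2, Real.toNNReal_pos.2 (by positivity), by positivity, ?_⟩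
  intro X f Ψ Ξ _ hXR hf hΨ hlow _ hmod hsm G hG G' hG'
  set t := opNorm (G.2 - G'.2) with ht
  set l := l1Dist (mixDensity f G) (mixDensity f G') with hl1
  have hlfin : l ≠ ∞ := l1Dist_mixDensity_ne_top hf hG.2 hG'.2
  have hP := ae_norm_le_of_support_subset _ hG.1 hXR
  have hQ := ae_norm_le_of_support_subset _ hG'.1 hXR
  have hWfin : W1 G.1 G'.1 ≠ ∞ :=
    ne_top_of_le_ne_top ENNReal.ofReal_ne_top (W1_le_two_mul _ _ hP hQ)
  have hpow : ∀ s : ℝ, 0 ≤ s →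
      W1 G.1 G'.1 ^ s = ENNReal.ofReal ((W1 G.1 G'.1).toReal ^ s) := fun s hs ↦ by
    rw [← ENNReal.ofReal_rpow_of_nonneg ENNReal.toReal_nonneg hs, ENNReal.ofReal_toReal hWfin]
  have hΨl : (D : ℝ≥0∞) * Ψ t ≤ l :=
    (mul_le_mul_left (ENNReal.coe_le_coe.2 (min_le_left _ _)) _).trans (hlow G hG G' hG')
  have hmin : (D : ℝ≥0∞) * min (W1 G.1 G'.1 ^ ((d : ℝ) + β + 1))
      (extendTop Ψ (incrInv Ξ ((K₂ * B)⁻¹.toNNReal * W1 G.1 G'.1 ^ ((d : ℝ) + p + 1)))) ≤ l := by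
    rcases hmain G.1 G'.1 (l.toReal / c₁) (B * Ξ t) (by positivity) (by positivity) hP hQ
      (norm_charFun_sub_le hf hc₁ hmod hsm hG.2 hG'.2) with h | h
    · calc _ ≤ ((c₁ / K₁).toNNReal : ℝ≥0∞) * W1 G.1 G'.1 ^ ((d : ℝ) + β + 1) := by
            gcongr
            · exact min_le_right _ _
            · exact min_le_left _ _
        _ = ENNReal.ofReal (c₁ / K₁ * (W1 G.1 G'.1).toReal ^ ((d : ℝ) + β + 1)) := by
            rw [hpow _ (by positivity), ENNReal.ofReal_mul (by positivity)]
            rfl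
        _ ≤ ENNReal.ofReal l.toReal := by
            refine ENNReal.ofReal_le_ofReal ?_
            calc c₁ / K₁ * (W1 G.1 G'.1).toReal ^ ((d : ℝ) + β + 1)
                ≤ c₁ / K₁ * (K₁ * (l.toReal / c₁)) := by gcongr
              _ = l.toReal := by field_simp
        _ = l := ENNReal.ofReal_toReal hlfin
    · have hΞt : ((K₂ * B)⁻¹.toNNReal : ℝ≥0∞) * W1 G.1 G'.1 ^ ((d : ℝ) + p + 1) ≤ Ξ t := by
        calc _ = ENNReal.ofReal ((K₂ * B)⁻¹ * (W1 G.1 G'.1).toReal ^ ((d : ℝ) + p + 1)) := by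
              rw [hpow _ (by positivity), ENNReal.ofReal_mul (by positivity)]
              rfl
          _ ≤ ENNReal.ofReal (Ξ t : ℝ) := by
              refine ENNReal.ofReal_le_ofReal ?_
              rw [inv_mul_le_iff₀ (by positivity)]
              linarith
          _ = Ξ t := ENNReal.ofReal_coe_nnreal
      refine le_trans ?_ hΨl
      gcongr
      exact (min_le_right _ _).trans (extendTop_incrInv_le hΨ hΞt)
  calc _ = 2⁻¹ * ((D : ℝ≥0∞) * Ψ t + (D : ℝ≥0∞) * min (W1 G.1 G'.1 ^ ((d : ℝ) + β + 1))
        (extendTop Ψ (incrInv Ξ ((K₂ * B)⁻¹.toNNReal * W1 G.1 G'.1 ^ ((d : ℝ) + p + 1))))) := by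
        rw [← mul_add, ENNReal.coe_div two_ne_zero, ENNReal.div_eq_inv_mul, mul_assoc]
        rfl
    _ ≤ 2⁻¹ * (l + l) := by gcongr
    _ = l := by
        rw [← two_mul, ← mul_assoc, ENNReal.inv_mul_cancel two_ne_zero ENNReal.ofNat_ne_top,
          one_mul]
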